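/- Let $m\ge 2$ and let $V_m=\{v_0<v_1<\cdots<v_{m-1}\}$ be the $m$-element Gödel chain with the implication $v_p\Rightarrow v_q=v_{m-1}$ if $p\le q$ and $v_p\Rightarrow v_q=v_q$ if $p>q$. For $n\ge1$ consider all full bracketings of $p_1\Rightarrow p_2\Rightarrow\cdots\Rightarrow p_n$ and, for each of them, all $m^n$ valuations $\{p_1,\dots,p_n\}\to V_m$; each pair (bracketing, valuation) has one output in $V_m$. Let $g_n^{(j)}$ be the number of outputs equal to $v_j$, $g_n=\sum_{j=0}^{m-1}g_n^{(j)}$, $G_j(x)=\sum_{n\ge1}g_n^{(j)}x^n$, $G(x)=\sum_{n\ge1}g_nx^n$ and $H_k(x)=\sum_{j=k}^{m-1}G_j(x)$. Put $p_j(m)=\lim_{n\to\infty}g_n^{(j)}/g_n$ and $q_k(m)=\sum_{j=k}^{m-1}p_j(m)$. Further let $r=\frac1{4m}$, $\Psi_x(v)=\frac{1+v-\sqrt{(1-v)^2+4x}}2$, $w_0=\frac12$ and $w_{j+1}=\Psi_r(w_j)$. Then the following hold. 1. For all $m\ge2$ and $0\le j\le m-1$ the limit $p_j(m)$ exists. 2.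 For all $m\ge2$ and $0\le k\le m-1$, $$q_k(m)=\lim_{n\to\infty}\frac{[x^n]H_k(x)}{[x^n]G(x)}=\lim_{n\to\infty}\frac{\#\{\text{outputs}\ge v_k\}}{\#\{\text{all outputs}\}}=\prod_{j=0}^{k-1}\partial_v\Psi_r(w_j),$$ where both limits exist. Moreover $q_{m-1}(m)=p_{m-1}(m)$, and $p_k(m)=q_k(m)-q_{k+1}(m)$ for $0\le k\le m-2$. 3. For every fixed $t\in[0,1]$, $q_{\lfloor t(m-1)\rfloor}(m)\to\frac1{\sqrt{1+2t}}$ as $m\to\infty$. 4. For every fixed $j$, $p_j(m)\to0$ as $m\to\infty$. 5. For every $t\in[0,1]$ and every sequence of ranks $0\le k_m\le m-1$, one has $q_{k_m}(m)\to\frac1{\sqrt{1+2t}}$ as $m\to\infty$ if and only if $k_m/(m-1)\to t$. -/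

import Mathlib

open Filter Topology

noncomputable section

namespace GodelChain

/-- Gödel implication on the chain `v_0 < ⋯ < v_{m-1}`, with `v_j` represented by `j : Fin m`. -/
def imp {m : ℕ} (p q : Fin m) : Fin m :=
  if p ≤ q then ⟨m - 1, Nat.sub_one_lt_of_lt p.isLt⟩ else q

/-- Full bracketings of `p_1 ⇒ p_2 ⇒ ⋯ ⇒ p_n`, as binary trees: the leaves, read from left
to right, are the variables `p_1, …, p_n`. -/
inductive Bracketing : Type
  | var : Bracketing
  | imp : Bracketing → Bracketing → Bracketing

/-- The number `n` of variables of a bracketing. -/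
def Bracketing.leaves : Bracketing → ℕ
  | .var => 1
  | .imp l r => l.leaves + r.leaves

/-- The truth value of a bracketing under a valuation of its variables. The first variables
belong to the left part, the remaining ones to the right part. -/
def Bracketing.eval {m : ℕ} : (b : Bracketing) → (Fin b.leaves → Fin m) → Fin m
  | .var, ν => ν (0 : Fin 1)
  | .imp l r, ν =>
      GodelChain.imp
        (l.eval fun i => ν (Fin.castAdd r.leaves i))
        (r.eval fun i => ν (Fin.natAdd l.leaves i))

/-- The rows of all the truth tables of the full bracketings on `n` variables: a bracketing
together with a valuation of its variables. -/
def Row (m n : ℕ) : Type :=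
  Σ b : {b : Bracketing // b.leaves = n}, (Fin b.1.leaves → Fin m)

/-- The output of a row. -/
def Row.output {m n : ℕ} (e : Row m n) : Fin m := e.1.1.eval e.2

/-- `g_n^{(j)}`: the number of outputs equal to `v_j`. -/
def levelCount (m n j : ℕ) : ℕ := Nat.card {e : Row m n // (e.output : ℕ) = j}

/-- `g_n = ∑_{j<m} g_n^{(j)}`. -/
def totalCount (m n : ℕ) : ℕ := ∑ j ∈ Finset.range m, levelCount m n j

/-- The number of outputs `≥ v_k`. -/
def atLeastCount (m n k : ℕ) : ℕ := Nat.card {e : Row m n // k ≤ (e.output : ℕ)}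

/-- `G_j(x) = ∑_{n ≥ 1} g_n^{(j)} x^n` (the coefficient of `x^0` vanishes, since no bracketing
has `0` variables). -/
def levelSeries (m j : ℕ) : PowerSeries ℝ := PowerSeries.mk fun n => (levelCount m n j : ℝ)

/-- `G(x) = ∑_{n ≥ 1} g_n x^n`. -/
def totalSeries (m : ℕ) : PowerSeries ℝ := PowerSeries.mk fun n => (totalCount m n : ℝ)

/-- The tail sum `H_k = G_k + ⋯ + G_{m-1}`. -/
def tailSeries (m k : ℕ) : PowerSeries ℝ := ∑ j ∈ Finset.Ico k m, levelSeries m j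

/-- `p_j(m) = lim_{n → ∞} g_n^{(j)} / g_n`. -/
def p (m j : ℕ) : ℝ :=
  limUnder atTop fun n : ℕ => (levelCount m n j : ℝ) / (totalCount m n : ℝ)

/-- `q_k(m) = p_k(m) + ⋯ + p_{m-1}(m)`. -/
def q (m k : ℕ) : ℝ := ∑ j ∈ Finset.Ico k m, p m j

/-- `Ψ_x(v) = (1 + v - √((1 - v)² + 4x)) / 2`. -/
def Psi (x v : ℝ) : ℝ := (1 + v - √((1 - v) ^ 2 + 4 * x)) / 2

/-- The critical point `r = 1 / (4m)`. -/
def r (m : ℕ) : ℝ := 1 / (4 * (m : ℝ))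

/-- The critical iterates `w_0 = 1/2`, `w_{k+1} = Ψ_r(w_k)`. -/
def w (m : ℕ) : ℕ → ℝ
  | 0 => 1 / 2
  | k + 1 => Psi (r m) (w m k)

end GodelChain

end

open Finset.HasAntidiagonal (antidiagonal)

/-! For j < m-1 an implication has value v_j exactly when its right side is v_j and its left side
exceeds v_j, so G_j = x + H_{j+1} G_j. With G_j = H_j - H_{j+1} this becomes (H_j - H_{j+1})(1 -
H_{j+1}) = x, that is, H_{j+1} = Ψ_x(H_j). All rows together number C_{n-1} m^n, so the critical
point is r = 1/(4m), where G(r) = 1/2 and hence H_k(r) = w_k.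

That the coefficients of H_{k+1} are asymptotically ∂Ψ_r(w_k) times those of H_k is proved by real
analysis. After scaling by r^n, compare with the weight a_n = C_{n-1}/4^n, which is summable and
asymptotically shift-invariant. In a convolution only the terms near the two ends matter; this turns
G_k = x + H_{k+1} G_k into a linear renewal equation for the ratios, which is contracting because
the total mass is at most 1/2 (`RegularWeight.tendsto_div_of_convolution`, applied in
`tsum_and_tendsto_atLeastCount`).

For large m put s_k = 1 - w_k. The recursion gives s_{k+1}² = s_k² + 2r - O(r²), so 4 s_k² ≈ 1 +
2k/m. The derivative factor s_{k+1}/(2s_{k+1} - s_k) equals s_k/s_{k+1} up to a relative error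
O(r²), so the product telescopes to q_k ≈ 1/(2 s_k). Thus q_k^{-2} = 1 + 2k/m + O(1/m) uniformly in
k (`abs_inv_q_sq_sub_le`), which yields all the limits in m, including the converse. -/

namespace GodelChain

/-! ### Decomposition and finiteness of valued bracketings -/

/-- A bracketing together with a valuation of its variables. -/
abbrev Instance (m : ℕ) : Type := Σ b : Bracketing, (Fin b.leaves → Fin m)

/-- An instance is a single valued variable or an implication between two instances. -/
def instanceEquiv (m : ℕ) : Instance m ≃ Fin m ⊕ (Instance m × Instance m) where
  toFun
    | ⟨.var, ν⟩ => .inl (ν (0 : Fin 1))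
    | ⟨.imp s t, ν⟩ => .inr (⟨s, fun i => ν (Fin.castAdd t.leaves i)⟩,
        ⟨t, fun i => ν (Fin.natAdd s.leaves i)⟩)
  invFun
    | .inl a => ⟨.var, fun _ => a⟩
    | .inr (⟨s, μ⟩, ⟨t, ν⟩) => ⟨.imp s t, Fin.append μ ν⟩
  left_inv := by
    rintro ⟨_ | ⟨s, t⟩, ν⟩
    · change (⟨Bracketing.var, fun _ => ν (0 : Fin 1)⟩ : Instance m) = ⟨.var, ν⟩
      congr 1
      funext i
      exact congrArg ν (Subsingleton.elim (α := Fin 1) _ _)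
    · change (⟨Bracketing.imp s t, Fin.append _ _⟩ : Instance m) = ⟨.imp s t, ν⟩
      congr 1
      exact Fin.append_castAdd_natAdd
  right_inv := by
    rintro (a | ⟨⟨s, μ⟩, ⟨t, ν⟩⟩)
    · rfl
    · change Sum.inr ((⟨s, fun i => Fin.append μ ν (Fin.castAdd t.leaves i)⟩ : Instance m),
        (⟨t, fun i => Fin.append μ ν (Fin.natAdd s.leaves i)⟩ : Instance m)) = _
      simp

/-- The instances on `n` variables whose value satisfies `P`. -/
abbrev InstanceOn (m n : ℕ) (P : Fin m → Prop) : Type :=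
  {e : Instance m // e.1.leaves = n ∧ P (e.1.eval e.2)}

def rowEquiv (m n : ℕ) (P : Fin m → Prop) :
    {e : Row m n // P e.output} ≃ InstanceOn m n P where
  toFun e := ⟨⟨e.1.1.1, e.1.2⟩, e.1.1.2, e.2⟩
  invFun e := ⟨⟨⟨e.1.1, e.2.1⟩, e.1.2⟩, e.2.2⟩
  left_inv _ := rfl
  right_inv _ := rfl

theorem Bracketing.leaves_pos (b : Bracketing) : 0 < b.leaves := by
  induction b with
  | var => exact Nat.one_pos
  | imp s t hs _ => exact Nat.add_pos_left hs _

theorem isEmpty_instanceOn_zero (m : ℕ) (P : Fin m → Prop) : IsEmpty (InstanceOn m 0 P) :=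
  ⟨fun e => e.1.1.leaves_pos.ne' e.2.1⟩

def instanceOnOneEquiv (m : ℕ) (P : Fin m → Prop) : InstanceOn m 1 P ≃ {a : Fin m // P a} where
  toFun
    | ⟨⟨.var, ν⟩, h⟩ => ⟨ν (0 : Fin 1), h.2⟩
    | ⟨⟨.imp s t, _⟩, h⟩ => absurd h.1 (by
        have := s.leaves_pos; have := t.leaves_pos
        change s.leaves + t.leaves ≠ 1; omega)
  invFun a := ⟨⟨.var, fun _ => a.1⟩, rfl, a.2⟩
  left_inv := by
    rintro ⟨⟨_ | ⟨s, t⟩, ν⟩, h⟩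
    · apply Subtype.ext
      exact (instanceEquiv m).left_inv ⟨.var, ν⟩
    · exact absurd h.1 (by
        have := s.leaves_pos; have := t.leaves_pos
        change s.leaves + t.leaves ≠ 1; omega)
  right_inv _ := rfl

/-- If the value of an implication satisfies `P` exactly when its two sides satisfy `A` and `B`,
then the instances satisfying `P` split into pairs of smaller instances. -/
def instanceOnEquiv {m n : ℕ} (hn : n ≠ 1) {P A B : Fin m → Prop}
    (h : ∀ a b, P (imp a b) ↔ A a ∧ B b) :
    InstanceOn m n P ≃
      Σ x : antidiagonal n, InstanceOn m x.1.1 A × InstanceOn m x.1.2 B where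
  toFun
    | ⟨⟨.var, _⟩, h'⟩ => absurd h'.1.symm hn
    | ⟨⟨.imp s t, ν⟩, h'⟩ =>
        ⟨⟨(s.leaves, t.leaves), Finset.HasAntidiagonal.mem_antidiagonal.2 h'.1⟩,
          ⟨⟨s, fun i => ν (Fin.castAdd t.leaves i)⟩, rfl, ((h _ _).1 h'.2).1⟩,
          ⟨⟨t, fun i => ν (Fin.natAdd s.leaves i)⟩, rfl, ((h _ _).1 h'.2).2⟩⟩
  invFun x := ⟨(instanceEquiv m).symm (.inr (x.2.1.1, x.2.2.1)), by
    obtain ⟨⟨⟨a, b⟩, hab⟩, ⟨⟨s, μ⟩, hs, hA⟩, ⟨⟨t, ν⟩, ht, hB⟩⟩ := x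
    refine ⟨?_, ?_⟩
    · change s.leaves + t.leaves = n
      rw [← Finset.HasAntidiagonal.mem_antidiagonal.1 hab, ← hs, ← ht]
    · change P (imp (s.eval fun i => Fin.append μ ν (Fin.castAdd t.leaves i))
        (t.eval fun i => Fin.append μ ν (Fin.natAdd s.leaves i)))
      rw [h]
      simpa using ⟨hA, hB⟩⟩
  left_inv := by
    rintro ⟨⟨_ | ⟨s, t⟩, ν⟩, h'⟩
    · exact absurd h'.1.symm hn
    · apply Subtype.ext
      exact (instanceEquiv m).left_inv ⟨.imp s t, ν⟩
  right_inv := by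
    rintro ⟨⟨⟨a, b⟩, hab⟩, ⟨⟨s, μ⟩, hs, hA⟩, ⟨⟨t, ν⟩, ht, hB⟩⟩
    dsimp only at hs ht
    subst hs ht
    change (⟨⟨(s.leaves, t.leaves), hab⟩,
      ⟨⟨s, fun i => Fin.append μ ν (Fin.castAdd t.leaves i)⟩, _⟩,
      ⟨⟨t, fun i => Fin.append μ ν (Fin.natAdd s.leaves i)⟩, _⟩⟩ :
        Σ x : antidiagonal n, InstanceOn m x.1.1 A × InstanceOn m x.1.2 B) = _
    congr 1
    refine Prod.ext (Subtype.ext ?_) (Subtype.ext ?_) <;> simp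

theorem finite_instanceOn_true (m n : ℕ) : Finite (InstanceOn m n fun _ => True) := by
  induction n using Nat.strong_induction_on with
  | _ n ih =>
    rcases eq_or_ne n 0 with rfl | h0
    · have := isEmpty_instanceOn_zero m fun _ => True
      infer_instance
    rcases eq_or_ne n 1 with rfl | h1
    · exact Finite.of_equiv _ (instanceOnOneEquiv m fun _ => True).symm
    · let e := instanceOnEquiv (m := m) h1 (P := fun _ => True) (A := fun _ => True)
        (B := fun _ => True) (by simp)
      have hfin : ∀ x : antidiagonal n,
          Finite ((InstanceOn m x.1.1 fun _ => True) × (InstanceOn m x.1.2 fun _ => True)) := by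
        rintro ⟨⟨a, b⟩, hab⟩
        have hab' := Finset.HasAntidiagonal.mem_antidiagonal.1 hab
        dsimp only at hab' ⊢
        rcases Nat.eq_zero_or_pos a with rfl | ha
        · have := isEmpty_instanceOn_zero m fun _ => True
          infer_instance
        -- A part with no leaves makes the product empty; otherwise both parts are smaller than n
        -- and induction applies.
        rcases Nat.eq_zero_or_pos b with rfl | hb
        · have := isEmpty_instanceOn_zero m fun _ => True
          infer_instance
        have := ih a (by omega)
        have := ih b (by omega)
        infer_instance
      exact Finite.of_equiv _ e.symm

instance finite_instanceOn (m n : ℕ) (P : Fin m → Prop) : Finite (InstanceOn m n P) :=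
  have := finite_instanceOn_true m n
  Finite.of_injective
    (fun e : InstanceOn m n P => (⟨e.1, e.2.1, trivial⟩ : InstanceOn m n fun _ => True))
    fun _ _ h => Subtype.ext (congrArg (fun x : InstanceOn m n fun _ => True => x.1) h)

/-! ### Counting rows and the recursions between levels -/

/-- The number of rows on `n` variables whose output satisfies `P`. -/
noncomputable def count (m n : ℕ) (P : Fin m → Prop) : ℕ := Nat.card {e : Row m n // P e.output}

instance finite_row_subtype (m n : ℕ) (P : Fin m → Prop) : Finite {e : Row m n // P e.output} :=
  Finite.of_equiv _ (rowEquiv m n P).symm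

theorem count_zero (m : ℕ) (P : Fin m → Prop) : count m 0 P = 0 := by
  rw [count, Nat.card_congr (rowEquiv m 0 P)]
  have := isEmpty_instanceOn_zero m P
  exact Nat.card_of_isEmpty

theorem count_one (m : ℕ) (P : Fin m → Prop) : count m 1 P = Nat.card {a : Fin m // P a} := by
  rw [count, Nat.card_congr (rowEquiv m 1 P), Nat.card_congr (instanceOnOneEquiv m P)]

theorem count_of_ne_one {m n : ℕ} (hn : n ≠ 1) {P A B : Fin m → Prop}
    (h : ∀ a b, P (imp a b) ↔ A a ∧ B b) :
    count m n P = ∑ x ∈ antidiagonal n, count m x.1 A * count m x.2 B := by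
  simp only [count, Nat.card_congr (rowEquiv m _ _)]
  rw [Nat.card_congr (instanceOnEquiv hn h), Nat.card_sigma,
    ← Finset.sum_coe_sort (antidiagonal n)]
  simp only [Nat.card_prod]

theorem levelCount_eq_count (m n j : ℕ) : levelCount m n j = count m n fun a => (a : ℕ) = j := rfl

theorem atLeastCount_eq_count (m n k : ℕ) : atLeastCount m n k = count m n fun a => k ≤ (a : ℕ) :=
  rfl

theorem card_row_eq_count (m n : ℕ) : Nat.card (Row m n) = count m n fun _ => True :=
  Nat.card_congr (Equiv.subtypeUnivEquiv fun _ => trivial).symm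

theorem card_row_eq_atLeastCount (m n : ℕ) : Nat.card (Row m n) = atLeastCount m n 0 := by
  simp only [card_row_eq_count, atLeastCount_eq_count, Nat.zero_le]

theorem atLeastCount_eq_add (m n k : ℕ) :
    atLeastCount m n k = levelCount m n k + atLeastCount m n (k + 1) := by
  classical
  simp only [levelCount, atLeastCount]
  have e : {e : Row m n // k ≤ (e.output : ℕ)} ≃
      {e : Row m n // (e.output : ℕ) = k ∨ k + 1 ≤ (e.output : ℕ)} :=
    Equiv.subtypeEquivRight fun e => by omega
  have := finite_row_subtype m n fun a => (a : ℕ) = k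
  have := finite_row_subtype m n fun a => k + 1 ≤ (a : ℕ)
  rw [Nat.card_congr e, Nat.card_congr (subtypeOrEquiv _ _ ?_), Nat.card_sum]
  rw [Pi.disjoint_iff]
  intro x
  rw [Prop.disjoint_iff]
  omega

theorem atLeastCount_of_le {m k : ℕ} (n : ℕ) (h : m ≤ k) : atLeastCount m n k = 0 := by
  have : IsEmpty {e : Row m n // k ≤ (e.output : ℕ)} :=
    ⟨fun e => absurd e.1.output.isLt (not_lt.2 (h.trans e.2))⟩
  exact Nat.card_of_isEmpty

theorem atLeastCount_eq_sum {m k : ℕ} (n : ℕ) (h : k ≤ m) :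
    atLeastCount m n k = ∑ j ∈ Finset.Ico k m, levelCount m n j := by
  induction h using Nat.decreasingInduction with
  | self => simp [atLeastCount_of_le]
  | of_succ k hk ih => rw [atLeastCount_eq_add, ih, Finset.sum_eq_sum_Ico_succ_bot hk]

theorem totalCount_eq_atLeastCount (m n : ℕ) : totalCount m n = atLeastCount m n 0 := by
  rw [atLeastCount_eq_sum n m.zero_le, totalCount, Finset.range_eq_Ico]

/-- A premise not exceeding the conclusion yields the top value, which differs from j because j + 1
< m. At the top level the equivalence would fail. -/
theorem imp_eq_iff {m : ℕ} {j : ℕ} (hj : j + 1 < m) (a b : Fin m) :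
    (imp a b : ℕ) = j ↔ j + 1 ≤ (a : ℕ) ∧ (b : ℕ) = j := by
  unfold imp
  split_ifs with h
  · have : (a : ℕ) ≤ b := h
    change m - 1 = j ↔ _
    omega
  · have : ¬ (a : ℕ) ≤ b := h
    omega

theorem levelCount_zero (m j : ℕ) : levelCount m 0 j = 0 := by
  rw [levelCount_eq_count, count_zero]

theorem atLeastCount_zero (m k : ℕ) : atLeastCount m 0 k = 0 := by
  rw [atLeastCount_eq_count, count_zero]

theorem levelCount_one {m j : ℕ} (hj : j < m) : levelCount m 1 j = 1 := by
  rw [levelCount_eq_count, count_one, Nat.card_eq_one_iff_unique]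
  exact ⟨⟨fun a b => Subtype.ext (Fin.ext (a.2.trans b.2.symm))⟩, ⟨⟨⟨j, hj⟩, rfl⟩⟩⟩

theorem levelCount_of_ne_one {m n j : ℕ} (hj : j + 1 < m) (hn : n ≠ 1) :
    levelCount m n j = ∑ x ∈ antidiagonal n,
      atLeastCount m x.1 (j + 1) * levelCount m x.2 j :=
  count_of_ne_one (P := fun a : Fin m => (a : ℕ) = j) (A := fun a : Fin m => j + 1 ≤ (a : ℕ)) hn
    (imp_eq_iff hj)

theorem card_row_one (m : ℕ) : Nat.card (Row m 1) = m := by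
  rw [card_row_eq_count, count_one, Nat.card_congr (Equiv.subtypeUnivEquiv fun _ => trivial),
    Nat.card_fin]

theorem card_row_of_ne_one {m n : ℕ} (hn : n ≠ 1) :
    Nat.card (Row m n) = ∑ x ∈ antidiagonal n,
      Nat.card (Row m x.1) * Nat.card (Row m x.2) := by
  simp only [card_row_eq_count]
  exact count_of_ne_one hn (by simp)

theorem card_row_zero (m : ℕ) : Nat.card (Row m 0) = 0 := by
  rw [card_row_eq_count, count_zero]

/-- The row counts satisfy the Catalan convolution; the two end terms vanish because there are no
rows on 0 variables. -/
theorem card_row_succ (m n : ℕ) : Nat.card (Row m (n + 1)) = catalan n * m ^ (n + 1) := by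
  induction n using Nat.strong_induction_on with
  | _ n ih =>
    rcases n with _ | n
    · simp [card_row_one]
    · rw [card_row_of_ne_one (by omega), Finset.Nat.sum_antidiagonal_succ,
        Finset.Nat.sum_antidiagonal_succ', catalan_succ', Finset.sum_mul]
      simp only [card_row_zero, zero_mul, mul_zero, zero_add]
      refine Finset.sum_congr rfl fun x hx => ?_
      have := Finset.HasAntidiagonal.mem_antidiagonal.1 hx
      rw [ih x.1 (by omega), ih x.2 (by omega), ← this]
      ring

/-! ### Convolutions with regular weights -/

/-- Tannery's theorem with a growing range: extend each finite sum by zero and use dominated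
convergence for series. -/
theorem tendsto_sum_range_of_dominated {F : ℕ → ℕ → ℝ} {g bound : ℕ → ℝ} {N : ℕ → ℕ}
    (hN : Tendsto N atTop atTop) (hb : Summable bound)
    (hF : ∀ i, Tendsto (fun n => F n i) atTop (𝓝 (g i)))
    (hFb : ∀ᶠ n in atTop, ∀ i < N n, |F n i| ≤ bound i) :
    Tendsto (fun n => ∑ i ∈ Finset.range (N n), F n i) atTop (𝓝 (∑' i, g i)) := by
  have key : Tendsto (fun n => ∑' i, if i < N n then F n i else 0) atTop (𝓝 (∑' i, g i)) := by
    refine tendsto_tsum_of_dominated_convergence (bound := fun i => |bound i|) hb.abs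
      (fun i => ?_) ?_
    · refine (hF i).congr' ?_
      filter_upwards [hN.eventually_gt_atTop i] with n hn
      rw [if_pos hn]
    · filter_upwards [hFb] with n hn i
      split_ifs with h
      · exact (hn i h).trans (le_abs_self _)
      · simp
  refine key.congr fun n => ?_
  rw [tsum_eq_sum (s := Finset.range (N n)) fun i hi => if_neg (by simpa using hi)]
  exact Finset.sum_congr rfl fun i hi => if_pos (Finset.mem_range.1 hi)

/-- A summable positive sequence that is asymptotically invariant under shifts and decays at
most polynomially. -/
structure RegularWeight (a : ℕ → ℝ) : Prop where
  nonneg : ∀ n, 0 ≤ a n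
  pos : ∀ n, 0 < n → 0 < a n
  summable : Summable a
  tendsto_shift : ∀ i, Tendsto (fun n => a (n - i) / a n) atTop (𝓝 1)
  doubling : ∃ M, ∀ n i, 2 * i ≤ n → a (n - i) ≤ M * a n

theorem tendsto_half_succ_atTop : Tendsto (fun n : ℕ => n / 2 + 1) atTop atTop :=
  tendsto_atTop_mono (fun _ => Nat.le_succ _) (Nat.tendsto_div_const_atTop two_ne_zero)

theorem tendsto_succ_half_atTop : Tendsto (fun n : ℕ => (n + 1) / 2) atTop atTop :=
  (Nat.tendsto_div_const_atTop two_ne_zero).comp (tendsto_add_atTop_nat 1)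

/-- In half of a convolution, the shift of the weight may be ignored. -/
theorem RegularWeight.tendsto_sum_shift_sub {a f h : ℕ → ℝ} (ha : RegularWeight a) {C : ℝ}
    (hf : Summable f) (hh : ∀ n, |h n| ≤ C * a n) {N : ℕ → ℕ} (hN : Tendsto N atTop atTop)
    (hN' : ∀ n, ∀ i < N n, 2 * i ≤ n) :
    Tendsto (fun n => ∑ i ∈ Finset.range (N n), f i * h (n - i) / a n -
      ∑ i ∈ Finset.range (N n), f i * (h (n - i) / a (n - i))) atTop (𝓝 0) := by
  obtain ⟨M, hM⟩ := ha.doubling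
  have hx : ∀ n, 0 < n → |h n / a n| ≤ C := fun n hn => by
    rw [abs_div, abs_of_pos (ha.pos n hn), div_le_iff₀ (ha.pos n hn)]
    exact hh n
  -- The quotients of h by a are only bounded, but each is multiplied by a factor tending to 0. The
  -- restriction 2i ≤ n lets doubling supply the dominating series.
  have key : Tendsto (fun n => ∑ i ∈ Finset.range (N n),
      f i * (h (n - i) / a (n - i)) * (a (n - i) / a n - 1)) atTop (𝓝 (∑' _ : ℕ, (0 : ℝ))) := by
    refine tendsto_sum_range_of_dominated hN (bound := fun i => |f i| * (C * (M + 1)))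
      (hf.abs.mul_right _) (fun i => ?_) ?_
    · refine squeeze_zero_norm' (a := fun n => |f i| * C * |a (n - i) / a n - 1|) ?_ ?_
      · filter_upwards [eventually_gt_atTop i] with n hn
        rw [Real.norm_eq_abs, abs_mul, abs_mul]
        gcongr
        exact hx _ (by omega)
      · have := ((ha.tendsto_shift i).sub_const 1).abs.const_mul (|f i| * C)
        simpa using this
    · filter_upwards [eventually_gt_atTop 0] with n hn i hi
      have h2 := hN' n i hi
      have hC : |h (n - i) / a (n - i)| ≤ C := hx _ (by omega)
      have hq : a (n - i) / a n ≤ M := (div_le_iff₀ (ha.pos n hn)).2 (hM n i h2)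
      have hq0 : 0 ≤ a (n - i) / a n := div_nonneg (ha.nonneg _) (ha.nonneg _)
      have h1 : |a (n - i) / a n - 1| ≤ M + 1 := by rw [abs_le]; constructor <;> linarith
      rw [abs_mul, abs_mul, mul_assoc]
      exact mul_le_mul_of_nonneg_left
        (mul_le_mul hC h1 (abs_nonneg _) ((abs_nonneg _).trans hC)) (abs_nonneg _)
  rw [tsum_zero] at key
  refine key.congr' ?_
  filter_upwards [eventually_gt_atTop 0] with n hn
  rw [← Finset.sum_sub_distrib]
  refine Finset.sum_congr rfl fun i hi => ?_
  have h2 := hN' n i (Finset.mem_range.1 hi)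
  have h3 := (ha.pos (n - i) (by omega)).ne'
  have h4 := (ha.pos n hn).ne'
  field_simp

/-- A convolution, cut at its middle. -/
theorem sum_antidiagonal_eq_add_half (f h : ℕ → ℝ) (n : ℕ) :
    ∑ x ∈ antidiagonal n, f x.1 * h x.2 =
      ∑ i ∈ Finset.range (n / 2 + 1), f i * h (n - i) +
        ∑ i ∈ Finset.range ((n + 1) / 2), h i * f (n - i) := by
  rw [Finset.Nat.sum_antidiagonal_eq_sum_range_succ fun i j => f i * h j,
    show n.succ = (n / 2 + 1) + (n + 1) / 2 by omega, Finset.sum_range_add]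
  congr 1
  rw [← Finset.sum_range_reflect]
  refine Finset.sum_congr rfl fun i hi => ?_
  have := Finset.mem_range.1 hi
  rw [mul_comm]
  congr 2 <;> omega

/-- Solutions of an asymptotically contracting renewal equation tend to zero. -/
theorem tendsto_zero_of_contracting {y : ℕ → ℝ} {V C : ℝ} (hV0 : 0 ≤ V) (hV : V < 1)
    (hy : ∀ᶠ n in atTop, |y n| ≤ C)
    (hc : ∀ ε > 0, ∀ L, (∀ᶠ n in atTop, |y n| ≤ L) → ∀ᶠ n in atTop, |y n| ≤ ε + V * L) :
    Tendsto y atTop (𝓝 0) := by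
  -- Iterating L ↦ ε + V L from the initial bound C; the fixed point is ε / (1 - V).
  have hpow : ∀ ε > 0, ∀ k : ℕ, ∀ᶠ n in atTop, |y n| ≤ ε / (1 - V) + V ^ k * C := by
    intro ε hε k
    have h1 : 0 < 1 - V := sub_pos.2 hV
    induction k with
    | zero =>
      filter_upwards [hy] with n hn
      have : 0 < ε / (1 - V) := by positivity
      simpa using by linarith
    | succ k ih =>
      filter_upwards [hc ε hε _ ih] with n hn
      refine hn.trans (le_of_eq ?_)
      field_simp
      ring
  rw [Metric.tendsto_atTop']
  intro ε hε
  have h1 : 0 < 1 - V := sub_pos.2 hV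
  have hk : Tendsto (fun k : ℕ => V ^ k * C) atTop (𝓝 0) := by
    simpa using (tendsto_pow_atTop_nhds_zero_of_lt_one hV0 hV).mul_const C
  obtain ⟨k, hk⟩ := (hk.eventually_lt_const (half_pos hε)).exists
  have := hpow (ε / 2 * (1 - V)) (by positivity) k
  rw [mul_div_assoc, div_self h1.ne', mul_one] at this
  obtain ⟨n₀, hn₀⟩ := eventually_atTop.1 this
  refine ⟨n₀, fun n hn => ?_⟩
  rw [dist_zero_right, Real.norm_eq_abs]
  linarith [hn₀ n hn.le]

theorem abs_sum_range_mul_le {f y : ℕ → ℝ} {L : ℝ} {n N : ℕ} (hf0 : ∀ n, 0 ≤ f n)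
    (hf : Summable f) (hL : 0 ≤ L) (hy : ∀ i < N, |y (n - i)| ≤ L) :
    |∑ i ∈ Finset.range N, f i * y (n - i)| ≤ (∑' i, f i) * L := by
  calc |∑ i ∈ Finset.range N, f i * y (n - i)|
      ≤ ∑ i ∈ Finset.range N, f i * L := by
        refine (Finset.abs_sum_le_sum_abs _ _).trans (Finset.sum_le_sum fun i hi => ?_)
        rw [abs_mul, abs_of_nonneg (hf0 i)]
        exact mul_le_mul_of_nonneg_left (hy i (Finset.mem_range.1 hi)) (hf0 i)
    _ ≤ (∑' i, f i) * L := by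
        rw [← Finset.sum_mul]
        exact mul_le_mul_of_nonneg_right (hf.sum_le_tsum _ fun i _ => hf0 i) hL

theorem tendsto_sum_range_mul_shift {f z : ℕ → ℝ} {l C : ℝ} {N : ℕ → ℕ} (hf : Summable f)
    (hN : Tendsto N atTop atTop) (hzb : ∀ n, |z n| ≤ C) (hz : Tendsto z atTop (𝓝 l)) :
    Tendsto (fun n => ∑ i ∈ Finset.range (N n), f i * z (n - i)) atTop
      (𝓝 ((∑' i, f i) * l)) := by
  rw [← tsum_mul_right]
  refine tendsto_sum_range_of_dominated hN (bound := fun i => |f i| * C) (hf.abs.mul_right _)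
    (fun i => (hz.comp (tendsto_sub_atTop_nat i)).const_mul _) (.of_forall fun n i _ => ?_)
  rw [abs_mul]
  exact mul_le_mul_of_nonneg_left (hzb _) (abs_nonneg _)

/-- If `d` solves the convolution equation `d = u * d` up to finitely many terms and `d + u` is
asymptotically proportional to a regular weight, then so is `d`. -/
theorem RegularWeight.tendsto_div_of_convolution {a d u : ℕ → ℝ} (ha : RegularWeight a) {C β : ℝ}
    (hd0 : ∀ n, 0 ≤ d n) (hu0 : ∀ n, 0 ≤ u n) (hC : ∀ n, d n + u n ≤ C * a n)
    (hβ : Tendsto (fun n => (d n + u n) / a n) atTop (𝓝 β))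
    (hconv : ∀ᶠ n in atTop, d n = ∑ x ∈ antidiagonal n, u x.1 * d x.2)
    (hlt : ∑' n, d n + ∑' n, u n < 1) :
    Tendsto (fun n => d n / a n) atTop
      (𝓝 ((∑' n, d n) * β / (1 - ∑' n, u n + ∑' n, d n))) := by
  have hdC : ∀ n, |d n| ≤ C * a n := fun n => by
    rw [abs_of_nonneg (hd0 n)]; linarith [hu0 n, hC n]
  have huC : ∀ n, |u n| ≤ C * a n := fun n => by
    rw [abs_of_nonneg (hu0 n)]; linarith [hd0 n, hC n]
  have hds : Summable d := .of_norm_bounded (ha.summable.mul_left C) hdC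
  have hus : Summable u := .of_norm_bounded (ha.summable.mul_left C) huC
  have hC0 : 0 ≤ C := by
    have := (hd0 1).trans ((le_abs_self _).trans (hdC 1))
    exact nonneg_of_mul_nonneg_left this (ha.pos 1 one_pos)
  have hquot : ∀ g : ℕ → ℝ, (∀ n, |g n| ≤ C * a n) → ∀ n, |g n / a n| ≤ C := fun g hg n => by
    rw [abs_div, abs_of_nonneg (ha.nonneg n)]
    exact div_le_of_le_mul₀ (ha.nonneg n) hC0 (hg n)
  have hvC : ∀ n, |(d n + u n) / a n| ≤ C :=
    hquot (fun n => d n + u n) fun n => by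
      have h0 : 0 ≤ d n + u n := by linarith [hd0 n, hu0 n]
      rw [abs_of_nonneg h0]
      exact hC n
  have hD0 : 0 ≤ ∑' n, d n := tsum_nonneg hd0
  have hU0 : 0 ≤ ∑' n, u n := tsum_nonneg hu0
  set D := ∑' n, d n with hD
  set U := ∑' n, u n with hU
  have hden : 0 < 1 - U + D := by linarith
  set ξ := D * β / (1 - U + D) with hξ
  -- ξ is the only possible limit: the end of the convolution where d has small index contributes D
  -- (β - ξ), the other contributes U ξ.
  have hξeq : ξ = D * β - D * ξ + U * ξ := by
    rw [hξ]; field_simp; ring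
  have h1 := ha.tendsto_sum_shift_sub hds huC tendsto_succ_half_atTop (fun n i hi => by omega)
  have h2 := ha.tendsto_sum_shift_sub hus hdC tendsto_half_succ_atTop (fun n i hi => by omega)
  have h3 := tendsto_sum_range_mul_shift hds tendsto_succ_half_atTop hvC hβ
  have h4 : Tendsto (fun n : ℕ => ∑ i ∈ Finset.range ((n + 1) / 2), d i * ξ) atTop (𝓝 (D * ξ)) :=
    tendsto_sum_range_mul_shift (z := fun _ => ξ) hds tendsto_succ_half_atTop (fun _ => le_rfl)
      tendsto_const_nhds
  have h5 : Tendsto (fun n : ℕ => ∑ i ∈ Finset.range (n / 2 + 1), u i * ξ) atTop (𝓝 (U * ξ)) :=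
    tendsto_sum_range_mul_shift (z := fun _ => ξ) hus tendsto_half_succ_atTop (fun _ => le_rfl)
      tendsto_const_nhds
  set y : ℕ → ℝ := fun n => d n / a n - ξ with hy
  -- The deviation y satisfies the homogeneous renewal equation up to o(1). Its coefficients have
  -- total absolute mass D + U < 1, which gives the contraction.
  have herr : Tendsto (fun n => y n + ∑ i ∈ Finset.range ((n + 1) / 2), d i * y (n - i) -
      ∑ i ∈ Finset.range (n / 2 + 1), u i * y (n - i)) atTop (𝓝 0) := by
    have hsum := ((((h1.add h2).add h3).sub h4).add h5).sub_const ξ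
    have hlim : 0 + 0 + D * β - D * ξ + U * ξ - ξ = 0 := by linarith
    rw [hlim] at hsum
    refine hsum.congr' ?_
    filter_upwards [hconv] with n hn
    have e : d n / a n = ∑ i ∈ Finset.range ((n + 1) / 2), d i * u (n - i) / a n +
        ∑ i ∈ Finset.range (n / 2 + 1), u i * d (n - i) / a n := by
      rw [← Finset.sum_div, ← Finset.sum_div, ← add_div, hn, sum_antidiagonal_eq_add_half]
      ring
    simp only [hy]
    rw [e]
    simp only [mul_sub, add_div, mul_add, Finset.sum_add_distrib, Finset.sum_sub_distrib]
    ring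
  suffices h : Tendsto y atTop (𝓝 0) by
    have := h.add_const ξ
    simpa [hy] using this
  refine tendsto_zero_of_contracting (V := D + U) (C := C + |ξ|) (by linarith) hlt
    (.of_forall fun n => ?_) fun ε hε L hL => ?_
  · exact (abs_sub _ _).trans (by linarith [hquot d hdC n])
  · obtain ⟨n₀, hn₀⟩ := eventually_atTop.1 hL
    have hL0 : 0 ≤ L := (abs_nonneg _).trans (hn₀ n₀ le_rfl)
    have herr' := herr.abs.eventually_le_const (u := ε) (by simpa using hε)
    filter_upwards [herr', eventually_ge_atTop (2 * n₀)] with n hn hn2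
    have b1 := abs_sum_range_mul_le (n := n) (N := (n + 1) / 2) hd0 hds hL0
      fun i hi => hn₀ (n - i) (by omega)
    have b2 := abs_sum_range_mul_le (n := n) (N := n / 2 + 1) hu0 hus hL0
      fun i hi => hn₀ (n - i) (by omega)
    rw [abs_le] at hn b1 b2 ⊢
    constructor <;> nlinarith

/-! ### The Catalan weight -/

/-- The shifted Catalan numbers, normalized at their radius of convergence. -/
noncomputable def catalanWeight : ℕ → ℝ
  | 0 => 0
  | n + 1 => catalan n / 4 ^ (n + 1)

theorem catalanWeight_zero : catalanWeight 0 = 0 := rfl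

theorem catalanWeight_one : catalanWeight 1 = 1 / 4 := by
  simp [catalanWeight]

theorem catalan_pos (n : ℕ) : 0 < catalan n :=
  Nat.pos_of_mul_pos_left ((succ_mul_catalan_eq_centralBinom n).symm ▸ n.centralBinom_pos)

theorem catalanWeight_pos {n : ℕ} (hn : 0 < n) : 0 < catalanWeight n := by
  obtain ⟨n, rfl⟩ := Nat.exists_eq_add_of_lt hn
  have := catalan_pos n
  rw [zero_add, catalanWeight]
  positivity

theorem catalanWeight_nonneg (n : ℕ) : 0 ≤ catalanWeight n := by
  rcases n.eq_zero_or_pos with rfl | h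
  · exact le_rfl
  · exact (catalanWeight_pos h).le

theorem catalanWeight_succ_succ (n : ℕ) :
    2 * (n + 2) * catalanWeight (n + 2) = (2 * n + 1) * catalanWeight (n + 1) := by
  have h := Nat.succ_mul_centralBinom_succ n
  rw [← succ_mul_catalan_eq_centralBinom, ← succ_mul_catalan_eq_centralBinom] at h
  have h' : ((n : ℝ) + 1) * ((n + 2) * catalan (n + 1)) =
      ((n : ℝ) + 1) * (2 * (2 * n + 1) * catalan n) := by
    have := congrArg (Nat.cast (R := ℝ)) h
    push_cast at this
    linarith
  have h'' := mul_left_cancel₀ (by positivity) h'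
  simp only [catalanWeight]
  rw [pow_succ 4 (n + 1)]
  field_simp
  linarith

/-- The two-term recurrence makes the partial sums telescope; the closed form bounds them by 1/2 and
so gives summability. -/
theorem sum_range_catalanWeight (n : ℕ) :
    ∑ i ∈ Finset.range (n + 1), catalanWeight i =
      1 / 2 - 2 * (n + 1) * catalanWeight (n + 1) := by
  induction n with
  | zero => simp [catalanWeight_zero, catalanWeight_one]; norm_num
  | succ n ih =>
    rw [Finset.sum_range_succ, ih]
    have := catalanWeight_succ_succ n
    push_cast
    linarith

theorem summable_catalanWeight : Summable catalanWeight := by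
  refine summable_of_sum_range_le (c := 1 / 2) catalanWeight_nonneg fun n => ?_
  rcases n with _ | n
  · simp
  · rw [sum_range_catalanWeight]
    have := catalanWeight_nonneg (n + 1)
    have : 0 ≤ 2 * ((n : ℝ) + 1) * catalanWeight (n + 1) := by positivity
    linarith

/-- The weight decays like n^(-3/2), so the factor n² more than compensates; this is the source of
the doubling bound. -/
theorem monotone_sq_mul_catalanWeight : Monotone fun n : ℕ => (n : ℝ) ^ 2 * catalanWeight n := by
  refine monotone_nat_of_le_succ fun n => ?_
  rcases n with _ | n
  · simpa using catalanWeight_nonneg 1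
  · have h := catalanWeight_succ_succ n
    have h0 := catalanWeight_nonneg (n + 1)
    have e : catalanWeight (n + 2) = (2 * n + 1) * catalanWeight (n + 1) / (2 * (n + 2)) := by
      rw [← h]; field_simp
    change _ ≤ (((n + 1 + 1 : ℕ) : ℝ)) ^ 2 * catalanWeight (n + 2)
    rw [e]
    push_cast
    have e2 : ((n : ℝ) + 1 + 1) ^ 2 * ((2 * n + 1) * catalanWeight (n + 1) / (2 * (n + 2))) =
        ((n + 2) * (2 * n + 1) / 2) * catalanWeight (n + 1) := by
      field_simp
      ring
    rw [e2]
    refine mul_le_mul_of_nonneg_right ?_ h0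
    have : (0 : ℝ) ≤ n := n.cast_nonneg
    nlinarith

theorem tendsto_catalanWeight_pred_div :
    Tendsto (fun n => catalanWeight (n - 1) / catalanWeight n) atTop (𝓝 1) := by
  rw [← tendsto_add_atTop_iff_nat 2]
  have h : Tendsto (fun n : ℕ => 1 + 3 / 2 * (1 / ((n : ℝ) + 1 / 2))) atTop (𝓝 1) := by
    have h1 : Tendsto (fun n : ℕ => (n : ℝ) + 1 / 2) atTop atTop :=
      tendsto_atTop_add_const_right _ _ tendsto_natCast_atTop_atTop
    have := (h1.inv_tendsto_atTop.const_mul (3 / 2)).const_add 1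
    simpa using this
  refine h.congr fun n => ?_
  have h1 := catalanWeight_succ_succ n
  have h2 := (catalanWeight_pos (n := n + 2) (by omega)).ne'
  change _ = catalanWeight (n + 1) / catalanWeight (n + 2)
  have e : catalanWeight (n + 1) = 2 * (n + 2) * catalanWeight (n + 2) / (2 * n + 1) := by
    rw [h1]; field_simp
  rw [e]
  field_simp
  ring

theorem regularWeight_catalanWeight : RegularWeight catalanWeight where
  nonneg := catalanWeight_nonneg
  pos _ := catalanWeight_pos
  summable := summable_catalanWeight
  tendsto_shift i := by
    induction i with
    | zero =>
      refine tendsto_const_nhds.congr' ?_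
      filter_upwards [eventually_gt_atTop 0] with n hn
      exact (div_self (catalanWeight_pos hn).ne').symm
    | succ i ih =>
      have := (tendsto_catalanWeight_pred_div.comp (tendsto_sub_atTop_nat i)).mul ih
      rw [one_mul] at this
      refine this.congr' ?_
      filter_upwards [eventually_gt_atTop i] with n hn
      have h := (catalanWeight_pos (n := n - i) (by omega)).ne'
      simp only [Function.comp, Nat.sub_add_eq]
      field_simp
  doubling := by
    refine ⟨4, fun n i h => ?_⟩
    rcases n.eq_zero_or_pos with rfl | hn
    · simp [catalanWeight_zero]
    have hm := monotone_sq_mul_catalanWeight (Nat.sub_le n i)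
    dsimp only at hm
    have hni : (n : ℝ) ≤ 2 * ((n - i : ℕ) : ℝ) := by exact_mod_cast (by omega : n ≤ 2 * (n - i))
    have hn' : (0 : ℝ) < n := by exact_mod_cast hn
    have hsq : (n : ℝ) ^ 2 ≤ 4 * ((n - i : ℕ) : ℝ) ^ 2 := by nlinarith
    have h0 := catalanWeight_nonneg (n - i)
    have : (n : ℝ) ^ 2 * catalanWeight (n - i) ≤ (n : ℝ) ^ 2 * (4 * catalanWeight n) := by
      nlinarith [mul_le_mul_of_nonneg_right hsq h0]
    exact le_of_mul_le_mul_left this (by positivity)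

theorem tsum_eq_add_mul_of_convolution {f u d : ℕ → ℝ} {c : ℝ} (hu : Summable u)
    (hd : Summable d)
    (h : ∀ n, f n = (if n = 1 then c else 0) + ∑ x ∈ antidiagonal n, u x.1 * d x.2) :
    ∑' n, f n = c + (∑' n, u n) * ∑' n, d n := by
  have hs : Summable fun n : ℕ => if n = 1 then c else 0 :=
    summable_of_ne_finset_zero (s := {1}) fun n hn => if_neg (by simpa using hn)
  rw [tsum_congr h, hs.tsum_add (summable_norm_sum_mul_antidiagonal_of_summable_norm hu.norm
    hd.norm).of_norm, ← tsum_mul_tsum_eq_tsum_sum_antidiagonal_of_summable_norm hu.norm hd.norm,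
    tsum_ite_eq]

theorem catalanWeight_eq_convolution (n : ℕ) :
    catalanWeight n = (if n = 1 then 1 / 4 else 0) +
      ∑ x ∈ antidiagonal n, catalanWeight x.1 * catalanWeight x.2 := by
  rcases n with _ | _ | n
  · simp [catalanWeight_zero]
  · simp [catalanWeight_one, catalanWeight_zero, Finset.Nat.sum_antidiagonal_succ]
  · rw [Finset.Nat.sum_antidiagonal_succ, Finset.Nat.sum_antidiagonal_succ']
    simp only [catalanWeight, catalan_succ', zero_mul, mul_zero, zero_add]
    rw [if_neg (by omega), zero_add]
    push_cast
    rw [Finset.sum_div]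
    refine Finset.sum_congr rfl fun x hx => ?_
    rw [div_mul_div_comm, ← pow_add, ← Finset.HasAntidiagonal.mem_antidiagonal.1 hx]
    ring_nf

/-- The sum S satisfies S = 1/4 + S², whose double root is 1/2. -/
theorem tsum_catalanWeight : ∑' n, catalanWeight n = 1 / 2 := by
  have h := tsum_eq_add_mul_of_convolution summable_catalanWeight summable_catalanWeight
    catalanWeight_eq_convolution
  have : (∑' n, catalanWeight n - 1 / 2) ^ 2 = 0 := by linear_combination -h
  linarith [pow_eq_zero_iff two_ne_zero |>.1 this]

/-! ### Tail series at the critical point -/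

theorem r_pos {m : ℕ} (hm : 0 < m) : 0 < r m := by
  have : (0 : ℝ) < m := by exact_mod_cast hm
  unfold r
  positivity

theorem card_row_mul_r_pow {m : ℕ} (hm : 0 < m) (n : ℕ) :
    (Nat.card (Row m n) : ℝ) * r m ^ n = catalanWeight n := by
  have : (m : ℝ) ≠ 0 := by exact_mod_cast hm.ne'
  rcases n with _ | n
  · simp [card_row_zero, catalanWeight_zero]
  · rw [card_row_succ, catalanWeight, r, div_pow, mul_pow]
    push_cast
    field_simp
    simp

theorem levelCount_mul_pow_eq_convolution {m j : ℕ} (hj : j + 1 < m) (x : ℝ) (n : ℕ) :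
    (levelCount m n j : ℝ) * x ^ n = (if n = 1 then x else 0) +
      ∑ i ∈ antidiagonal n,
        ((atLeastCount m i.1 (j + 1) : ℝ) * x ^ i.1) * ((levelCount m i.2 j : ℝ) * x ^ i.2) := by
  split_ifs with hn
  · subst hn
    simp [levelCount_one (Nat.lt_of_succ_lt hj), levelCount_zero, atLeastCount_zero,
      Finset.Nat.sum_antidiagonal_succ]
  · rw [levelCount_of_ne_one hj hn, zero_add]
    push_cast
    rw [Finset.sum_mul]
    refine Finset.sum_congr rfl fun i hi => ?_
    rw [← Finset.HasAntidiagonal.mem_antidiagonal.1 hi, pow_add]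
    ring

theorem hasDerivAt_Psi {x v : ℝ} (h : 0 < (1 - v) ^ 2 + 4 * x) :
    HasDerivAt (Psi x) ((1 + (1 - v) / √((1 - v) ^ 2 + 4 * x)) / 2) v := by
  have h1 : HasDerivAt (fun v : ℝ => (1 - v) ^ 2 + 4 * x) (-2 * (1 - v)) v := by
    have := (((hasDerivAt_id v).const_sub 1).pow 2).add_const (4 * x)
    refine this.congr_deriv ?_
    simp
  have h2 := (((hasDerivAt_id v).const_add 1).sub (h1.sqrt h.ne')).div_const 2
  refine h2.congr_deriv ?_
  have := (Real.sqrt_pos.2 h).ne'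
  field_simp
  ring

/-- `Ψ_x(v)` is the solution `u` of `(v - u) (1 - u) = x` on the lower branch. -/
theorem sqrt_eq_of_mul_eq {x u v : ℝ} (h : (v - u) * (1 - u) = x) (hu : 2 * u ≤ 1 + v) :
    √((1 - v) ^ 2 + 4 * x) = 1 + v - 2 * u := by
  rw [← Real.sqrt_sq (by linarith : 0 ≤ 1 + v - 2 * u), ← h]
  ring_nf

theorem Psi_eq_of_mul_eq {x u v : ℝ} (h : (v - u) * (1 - u) = x) (hu : 2 * u ≤ 1 + v) :
    Psi x v = u := by
  rw [Psi, sqrt_eq_of_mul_eq h hu]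
  ring

theorem deriv_Psi_of_mul_eq {x u v : ℝ} (h : (v - u) * (1 - u) = x) (hu : 2 * u < 1 + v) :
    deriv (Psi x) v = (1 - u) / (1 + v - 2 * u) := by
  have hs := sqrt_eq_of_mul_eq h hu.le
  have hpos : 0 < (1 - v) ^ 2 + 4 * x := Real.sqrt_pos.1 (by rw [hs]; linarith)
  rw [(hasDerivAt_Psi hpos).deriv, hs]
  have : 1 + v - 2 * u ≠ 0 := by linarith
  field_simp
  ring

theorem atLeastCount_antitone (m n : ℕ) : Antitone (atLeastCount m n) :=
  antitone_nat_of_succ_le fun k => by rw [atLeastCount_eq_add m n k]; omega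

theorem atLeastCount_mul_r_pow_le {m : ℕ} (hm : 0 < m) (n k : ℕ) :
    (atLeastCount m n k : ℝ) * r m ^ n ≤ catalanWeight n := by
  rw [← card_row_mul_r_pow hm, card_row_eq_atLeastCount]
  have := (r_pos hm).le
  have : (atLeastCount m n k : ℝ) ≤ atLeastCount m n 0 := by
    exact_mod_cast atLeastCount_antitone m n k.zero_le
  gcongr

/-- The tail series `H_k` takes the value `w_k` at the critical point, and its coefficients are
asymptotically proportional to those of `G`. -/
theorem tsum_and_tendsto_atLeastCount {m k : ℕ} (hk : k < m) :
    ∑' n, (atLeastCount m n k : ℝ) * r m ^ n = w m k ∧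
    Tendsto (fun n => (atLeastCount m n k : ℝ) * r m ^ n / catalanWeight n) atTop
      (𝓝 (∏ j ∈ Finset.range k, deriv (Psi (r m)) (w m j))) := by
  have hm : 0 < m := by omega
  have hr := r_pos hm
  induction k with
  | zero =>
    simp only [← card_row_eq_atLeastCount, card_row_mul_r_pow hm, tsum_catalanWeight,
      Finset.range_zero, Finset.prod_empty]
    refine ⟨rfl, tendsto_const_nhds.congr' ?_⟩
    filter_upwards [eventually_gt_atTop 0] with n hn
    exact (div_self (catalanWeight_pos hn).ne').symm
  | succ k ih =>
    obtain ⟨hw, hlim⟩ := ih (by omega)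
    set d : ℕ → ℝ := fun n => (levelCount m n k : ℝ) * r m ^ n with hd
    set u : ℕ → ℝ := fun n => (atLeastCount m n (k + 1) : ℝ) * r m ^ n with hu
    have hd0 : ∀ n, 0 ≤ d n := fun n => by positivity
    have hu0 : ∀ n, 0 ≤ u n := fun n => by positivity
    have hv : ∀ n, (atLeastCount m n k : ℝ) * r m ^ n = d n + u n := fun n => by
      rw [atLeastCount_eq_add]; push_cast; ring
    have hC : ∀ n, d n + u n ≤ catalanWeight n := fun n =>
      hv n ▸ atLeastCount_mul_r_pow_le hm n k
    simp only [hv] at hw hlim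
    have hds : Summable d := summable_catalanWeight.of_nonneg_of_le hd0
      fun n => by linarith [hC n, hu0 n]
    have hus : Summable u := summable_catalanWeight.of_nonneg_of_le hu0
      fun n => by linarith [hC n, hd0 n]
    have hconv := levelCount_mul_pow_eq_convolution hk (r m)
    have hDU := tsum_eq_add_mul_of_convolution hus hds hconv
    have hsum : ∑' n, d n + ∑' n, u n = w m k := by rw [← hds.tsum_add hus, hw]
    have hle : ∑' n, d n + ∑' n, u n ≤ 1 / 2 := by
      rw [← hds.tsum_add hus, ← tsum_catalanWeight]
      exact (hds.add hus).tsum_le_tsum hC summable_catalanWeight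
    have hx := regularWeight_catalanWeight.tendsto_div_of_convolution (C := 1) hd0 hu0
      (by simpa using hC) hlim ?_ (by linarith)
    · have hD0 : 0 ≤ ∑' n, d n := tsum_nonneg hd0
      have hU0 : 0 ≤ ∑' n, u n := tsum_nonneg hu0
      change ∑' n, d n = r m + (∑' n, u n) * ∑' n, d n at hDU
      -- The equation D = r + U D with D = w_k - U is the quadratic defining Ψ_r; the bound D + U ≤
      -- 1/2 selects the lower branch.
      have hmul : (w m k - ∑' n, u n) * (1 - ∑' n, u n) = r m := by
        rw [← hsum]; linarith
      have hwu : Psi (r m) (w m k) = ∑' n, u n := Psi_eq_of_mul_eq hmul (by linarith)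
      refine ⟨hwu.symm, ?_⟩
      have hlim' := hlim.sub hx
      rw [Finset.prod_range_succ, deriv_Psi_of_mul_eq hmul (by linarith)]
      have hden : (1 - ∑' n, u n + ∑' n, d n) ≠ 0 := by linarith
      have hden' : 1 + w m k - 2 * ∑' n, u n = 1 - ∑' n, u n + ∑' n, d n := by linarith
      -- The limit for u is β - Dβ/(1 - U + D) = β (1 - U)/(1 - U + D), and the last factor is
      -- ∂Ψ_r(w_k).
      rw [hden']
      convert hlim' using 2
      · ring
      · field_simp
        ring
    · filter_upwards [eventually_gt_atTop 1] with n hn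
      have := hconv n
      rwa [if_neg hn.ne', zero_add] at this

/-! ### Limiting proportions for fixed m -/

theorem totalCount_eq_card_row (m n : ℕ) : totalCount m n = Nat.card (Row m n) := by
  rw [totalCount_eq_atLeastCount, card_row_eq_atLeastCount]

theorem tendsto_atLeastCount_div {m k : ℕ} (hk : k < m) :
    Tendsto (fun n => (atLeastCount m n k : ℝ) / totalCount m n) atTop
      (𝓝 (∏ j ∈ Finset.range k, deriv (Psi (r m)) (w m j))) := by
  have hm : 0 < m := by omega
  refine (tsum_and_tendsto_atLeastCount hk).2.congr fun n => ?_
  rw [← card_row_mul_r_pow hm, totalCount_eq_card_row,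
    mul_div_mul_right _ _ (pow_pos (r_pos hm) n).ne']

theorem tendsto_levelCount_div {m j : ℕ} (hj : j < m) :
    Tendsto (fun n => (levelCount m n j : ℝ) / totalCount m n) atTop (𝓝 (p m j)) := by
  obtain ⟨l, hl⟩ : ∃ l, Tendsto (fun n => (atLeastCount m n (j + 1) : ℝ) / totalCount m n)
      atTop (𝓝 l) := by
    rcases Nat.lt_or_ge (j + 1) m with h | h
    · exact ⟨_, tendsto_atLeastCount_div h⟩
    -- At the top level j = m - 1 nothing lies above, so the subtracted tail is identically zero.
    · exact ⟨0, by simp [atLeastCount_of_le _ h]⟩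
  refine tendsto_nhds_limUnder ⟨_, ((tendsto_atLeastCount_div hj).sub hl).congr fun n => ?_⟩
  rw [atLeastCount_eq_add m n j]
  push_cast
  ring

theorem tendsto_atLeastCount_div_q {m k : ℕ} (hk : k < m) :
    Tendsto (fun n => (atLeastCount m n k : ℝ) / totalCount m n) atTop (𝓝 (q m k)) := by
  refine (tendsto_finsetSum (Finset.Ico k m) fun j hj =>
    tendsto_levelCount_div (Finset.mem_Ico.1 hj).2).congr fun n => ?_
  rw [atLeastCount_eq_sum n hk.le, ← Finset.sum_div]
  push_cast
  rfl

theorem q_eq_prod {m k : ℕ} (hk : k < m) :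
    q m k = ∏ j ∈ Finset.range k, deriv (Psi (r m)) (w m j) :=
  tendsto_nhds_unique (tendsto_atLeastCount_div_q hk) (tendsto_atLeastCount_div hk)

theorem coeff_tailSeries {m k : ℕ} (n : ℕ) (hk : k ≤ m) :
    PowerSeries.coeff n (tailSeries m k) = atLeastCount m n k := by
  rw [tailSeries, map_sum, atLeastCount_eq_sum n hk]
  simp [levelSeries]

/-! ### Uniform estimates for the critical iterates -/

theorem Psi_spec {x : ℝ} (v : ℝ) (hx : 0 ≤ x) :
    (v - Psi x v) * (1 - Psi x v) = x ∧ Psi x v ≤ v := by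
  have h0 : 0 ≤ (1 - v) ^ 2 + 4 * x := by positivity
  refine ⟨?_, ?_⟩
  · have := Real.sq_sqrt h0
    unfold Psi
    linear_combination this / 4
  · have : 1 - v ≤ √((1 - v) ^ 2 + 4 * x) := Real.le_sqrt_of_sq_le (by linarith)
    unfold Psi
    linarith

theorem w_le_half {m : ℕ} (hm : 0 < m) (k : ℕ) : w m k ≤ 1 / 2 := by
  induction k with
  | zero => exact le_rfl
  | succ k ih => exact (Psi_spec _ (r_pos hm).le).2.trans ih

theorem w_succ_le {m : ℕ} (hm : 0 < m) (k : ℕ) : w m (k + 1) ≤ w m k :=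
  (Psi_spec _ (r_pos hm).le).2

theorem w_step {m : ℕ} (hm : 0 < m) (k : ℕ) :
    (w m k - w m (k + 1)) * (1 - w m (k + 1)) = r m :=
  (Psi_spec _ (r_pos hm).le).1

theorem w_sub_le {m : ℕ} (hm : 0 < m) (k : ℕ) : w m k - w m (k + 1) ≤ 2 * r m := by
  have := w_step hm k
  nlinarith [w_le_half hm (k + 1), w_succ_le hm k]

/-- Each step raises (1 - w)² by 2r minus the square of the increment, and the increment is at most
2r. -/
theorem one_sub_w_sq_bounds {m : ℕ} (hm : 0 < m) (k : ℕ) :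
    1 / 4 + 2 * r m * k - 4 * r m ^ 2 * k ≤ (1 - w m k) ^ 2 ∧
      (1 - w m k) ^ 2 ≤ 1 / 4 + 2 * r m * k := by
  induction k with
  | zero => norm_num [w]
  | succ k ih =>
    have h1 := w_step hm k
    have h2 := w_sub_le hm k
    have h3 := w_succ_le hm k
    have e : (1 - w m (k + 1)) ^ 2 =
        (1 - w m k) ^ 2 + 2 * r m - (w m k - w m (k + 1)) ^ 2 := by linear_combination 2 * h1
    have h4 : (w m k - w m (k + 1)) ^ 2 ≤ 4 * r m ^ 2 := by nlinarith
    push_cast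
    constructor <;> nlinarith [ih.1, ih.2, sq_nonneg (w m k - w m (k + 1))]

theorem deriv_Psi_w {m : ℕ} (hm : 0 < m) (k : ℕ) :
    deriv (Psi (r m)) (w m k) = (1 - w m (k + 1)) / (1 + w m k - 2 * w m (k + 1)) :=
  deriv_Psi_of_mul_eq (w_step hm k) (by linarith [w_le_half hm (k + 1), w_succ_le hm k])

/-- With s = 1 - w_k and s' = 1 - w_{k+1}, the identity s'² - s(2s' - s) = (s' - s)² shows that each
step multiplies the product times s by a factor at least 1. Since s' - s ≤ 2r ≤ 4r s', that factor
is at most 1/(1 - 16r²). -/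
theorem prod_deriv_Psi_bounds {m : ℕ} (hm : 0 < m) (k : ℕ) :
    1 / 2 ≤ (∏ j ∈ Finset.range k, deriv (Psi (r m)) (w m j)) * (1 - w m k) ∧
      (1 - 16 * r m ^ 2) ^ k *
        ((∏ j ∈ Finset.range k, deriv (Psi (r m)) (w m j)) * (1 - w m k)) ≤ 1 / 2 := by
  induction k with
  | zero => norm_num [w]
  | succ k ih =>
    rw [Finset.prod_range_succ, deriv_Psi_w hm]
    set P := ∏ j ∈ Finset.range k, deriv (Psi (r m)) (w m j)
    have h1 := w_sub_le hm k
    have h2 := w_succ_le hm k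
    have h3 := w_le_half hm k
    have h4 := w_le_half hm (k + 1)
    have hr := r_pos hm
    have hr4 : r m ≤ 1 / 4 := by
      have : (1 : ℝ) ≤ m := by exact_mod_cast hm
      unfold r
      rw [div_le_div_iff₀ (by positivity) (by norm_num)]
      linarith
    have hP : 0 < P := pos_of_mul_pos_left (by linarith [ih.1]) (by linarith : 0 ≤ 1 - w m k)
    have hden : 0 < 1 + w m k - 2 * w m (k + 1) := by linarith
    have e : P * ((1 - w m (k + 1)) / (1 + w m k - 2 * w m (k + 1))) * (1 - w m (k + 1)) =
        P * ((1 - w m (k + 1)) ^ 2 / (1 + w m k - 2 * w m (k + 1))) := by ring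
    rw [e]
    have hlow : 1 - w m k ≤ (1 - w m (k + 1)) ^ 2 / (1 + w m k - 2 * w m (k + 1)) := by
      rw [le_div_iff₀ hden]
      nlinarith [sq_nonneg (w m k - w m (k + 1))]
    have hup : (1 - 16 * r m ^ 2) *
        ((1 - w m (k + 1)) ^ 2 / (1 + w m k - 2 * w m (k + 1))) ≤ 1 - w m k := by
      rw [← mul_div_assoc, div_le_iff₀ hden]
      have h5 : (w m k - w m (k + 1)) ^ 2 ≤ (4 * r m * (1 - w m (k + 1))) ^ 2 := by
        apply pow_le_pow_left₀ (by linarith)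
        nlinarith
      nlinarith
    refine ⟨ih.1.trans (mul_le_mul_of_nonneg_left hlow hP.le), le_trans ?_ ih.2⟩
    rw [pow_succ, mul_assoc]
    refine mul_le_mul_of_nonneg_left ?_ (pow_nonneg (by nlinarith) _)
    rw [mul_left_comm]
    exact mul_le_mul_of_nonneg_left hup hP.le

theorem q_pos {m k : ℕ} (hk : k < m) : 0 < q m k := by
  have hm : 0 < m := by omega
  have h := (prod_deriv_Psi_bounds hm k).1
  rw [← q_eq_prod hk] at h
  exact pos_of_mul_pos_left (by linarith) (by linarith [w_le_half hm k] : 0 ≤ 1 - w m k)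

theorem abs_inv_q_sq_sub_le {m k : ℕ} (hk : k < m) :
    |(q m k ^ 2)⁻¹ - (1 + 2 * (k / m : ℝ))| ≤ 7 / m := by
  have hm : 0 < m := by omega
  have hm' : (1 : ℝ) ≤ m := by exact_mod_cast hm
  have hm0 : (0 : ℝ) < m := by linarith
  have hq := q_pos hk
  obtain ⟨h1, h2⟩ := prod_deriv_Psi_bounds hm k
  obtain ⟨h3, h4⟩ := one_sub_w_sq_bounds hm k
  rw [← q_eq_prod hk] at h1 h2
  set s := 1 - w m k with hs
  have hs0 : 1 / 2 ≤ s := by linarith [w_le_half hm k]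
  set x : ℝ := k / m with hx
  have hx0 : 0 ≤ x := by positivity
  have hx1 : x ≤ 1 := by
    rw [hx, div_le_one hm0]; exact_mod_cast hk.le
  set δ : ℝ := 1 / m with hδ
  have hδ0 : 0 < δ := by positivity
  have hδ1 : δ ≤ 1 := by rw [hδ, div_le_one hm0]; exact hm'
  have hrδ : r m = δ / 4 := by rw [hδ, r]; field_simp
  have hkx : (k : ℝ) * δ = x := by rw [hδ, hx]; ring
  have h3' : 1 + 2 * x - x * δ ≤ 4 * s ^ 2 := by
    rw [hrδ] at h3
    have e : 1 / 4 + 2 * (δ / 4) * (k : ℝ) - 4 * (δ / 4) ^ 2 * k =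
      1 / 4 + (k * δ) / 2 - (k * δ) * δ / 4 := by ring
    rw [e, hkx] at h3
    linarith
  have h4' : 4 * s ^ 2 ≤ 1 + 2 * x := by
    rw [hrδ] at h4
    have e : 1 / 4 + 2 * (δ / 4) * (k : ℝ) = 1 / 4 + (k * δ) / 2 := by ring
    rw [e, hkx] at h4
    linarith
  have hb : 1 - δ ≤ (1 - 16 * r m ^ 2) ^ k := by
    have e : 1 - 16 * r m ^ 2 = 1 + -(δ ^ 2) := by rw [hrδ]; ring
    rw [e]
    -- Bernoulli: (1 - δ²)^k ≥ 1 - kδ² = 1 - xδ ≥ 1 - δ.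
    refine le_trans ?_ (one_add_mul_le_pow (by nlinarith) k)
    have : (k : ℝ) * -(δ ^ 2) = -(x * δ) := by rw [← hkx]; ring
    rw [this]
    nlinarith
  have hlo : 2 * s * (1 - δ) ≤ (q m k)⁻¹ := by
    rw [← one_div, le_div_iff₀ hq]
    nlinarith [mul_le_mul_of_nonneg_right hb (by positivity : 0 ≤ q m k * s)]
  have hhi : (q m k)⁻¹ ≤ 2 * s := by
    rw [inv_le_iff_one_le_mul₀ hq]
    linarith
  have hinv : 0 < (q m k)⁻¹ := inv_pos.2 hq
  have hhi2 : (q m k)⁻¹ ^ 2 ≤ 4 * s ^ 2 := by nlinarith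
  have hlo2 : 4 * s ^ 2 * (1 - δ) ^ 2 ≤ (q m k)⁻¹ ^ 2 := by
    have := pow_le_pow_left₀ (mul_nonneg (by linarith) (by linarith)) hlo 2
    linarith [this, mul_pow (2 * s) (1 - δ) 2, mul_pow 2 s 2]
  rw [← inv_pow, show 7 / (m : ℝ) = 7 * δ by rw [hδ]; ring, abs_le]
  constructor
  -- The constant 7: 4s² ≤ 3 makes the factor 1 - 2δ cost at most 6δ, and the lower bound on 4s²
  -- loses another xδ ≤ δ.
  · have : 4 * s ^ 2 * (1 - 2 * δ) ≤ 4 * s ^ 2 * (1 - δ) ^ 2 := by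
      refine mul_le_mul_of_nonneg_left ?_ (by positivity)
      nlinarith
    nlinarith
  · linarith

/-! ### Limits as m grows -/

theorem tendsto_inv_q_sq_sub {k : ℕ → ℕ} (hk : ∀ᶠ m in atTop, k m < m) :
    Tendsto (fun m => (q m (k m) ^ 2)⁻¹ - (1 + 2 * ((k m : ℝ) / ((m : ℝ) - 1)))) atTop
      (𝓝 0) := by
  refine squeeze_zero_norm' (a := fun m : ℕ => 9 / (m : ℝ)) ?_
    (tendsto_const_div_atTop_nhds_zero_nat 9)
  filter_upwards [hk, eventually_ge_atTop 2] with m hm h2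
  have hm2 : (2 : ℝ) ≤ m := by exact_mod_cast h2
  have hkm : (k m : ℝ) + 1 ≤ m := by exact_mod_cast hm
  have h := abs_inv_q_sq_sub_le hm
  have e : (k m : ℝ) / ((m : ℝ) - 1) - k m / m = k m / ((m - 1) * m) := by
    have : (m : ℝ) - 1 ≠ 0 := by linarith
    field_simp
    ring
  have h0 : 0 ≤ (k m : ℝ) / (((m : ℝ) - 1) * m) :=
    div_nonneg (Nat.cast_nonneg _) (mul_nonneg (by linarith) (by linarith))
  have h1 : (k m : ℝ) / (((m : ℝ) - 1) * m) ≤ 1 / m := by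
    rw [← div_div]
    gcongr
    rw [div_le_one (by linarith)]
    linarith
  have e9 : 9 / (m : ℝ) = 7 / m + 2 * (1 / m) := by ring
  rw [Real.norm_eq_abs, e9]
  rw [abs_le] at h ⊢
  constructor <;> linarith [h.1, h.2]

theorem tendsto_one_div_sqrt_iff_inv_sq {ι : Type*} {l : Filter ι} {f : ι → ℝ} {c : ℝ}
    (hc : 0 < c) (hf : ∀ᶠ i in l, 0 < f i) :
    Tendsto f l (𝓝 (1 / √c)) ↔ Tendsto (fun i => (f i ^ 2)⁻¹) l (𝓝 c) := by
  have hs := Real.sqrt_pos.2 hc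
  constructor
  · intro h
    have h' := (h.pow 2).inv₀ (by positivity)
    rwa [div_pow, Real.sq_sqrt hc.le, one_pow, one_div, inv_inv] at h'
  · intro h
    have h' := h.sqrt.inv₀ hs.ne'
    rw [one_div]
    refine h'.congr' ?_
    filter_upwards [hf] with i hi
    rw [Real.sqrt_inv, inv_inv, Real.sqrt_sq hi.le]

/-- Since q^{-2} and 1 + 2k/(m-1) differ by o(1), either one converges exactly when the other does;
this gives both directions at once. -/
theorem tendsto_q_iff {k : ℕ → ℕ} {t : ℝ} (ht : 0 ≤ t) (hk : ∀ᶠ m in atTop, k m < m) :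
    Tendsto (fun m => q m (k m)) atTop (𝓝 (1 / √(1 + 2 * t))) ↔
      Tendsto (fun m : ℕ => (k m : ℝ) / ((m : ℝ) - 1)) atTop (𝓝 t) := by
  have h0 := tendsto_inv_q_sq_sub hk
  rw [tendsto_one_div_sqrt_iff_inv_sq (by positivity) (hk.mono fun _ => q_pos)]
  constructor
  · intro h
    have := ((h.sub h0).sub_const 1).div_const 2
    have e : (1 + 2 * t - 0 - 1) / 2 = t := by ring
    rw [e] at this
    exact this.congr fun m => by ring
  · intro h
    have := h0.add ((h.const_mul 2).const_add 1)
    rw [zero_add] at this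
    exact this.congr fun m => by ring

theorem p_eq_q_sub_q {m k : ℕ} (hk : k < m) : p m k = q m k - q m (k + 1) := by
  rw [q, q, Finset.sum_eq_sum_Ico_succ_bot hk]
  ring

theorem tendsto_natCast_sub_one_atTop : Tendsto (fun m : ℕ => (m : ℝ) - 1) atTop atTop :=
  tendsto_atTop_add_const_right _ (-1) tendsto_natCast_atTop_atTop

theorem tendsto_q_const (k : ℕ) : Tendsto (fun m => q m k) atTop (𝓝 1) := by
  have := (tendsto_q_iff (k := fun _ => k) le_rfl (eventually_gt_atTop k)).2
    (tendsto_natCast_sub_one_atTop.const_div_atTop _)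
  simpa using this

theorem tendsto_p_const (j : ℕ) : Tendsto (fun m => p m j) atTop (𝓝 0) := by
  have := (tendsto_q_const j).sub (tendsto_q_const (j + 1))
  rw [sub_self] at this
  refine this.congr' ?_
  filter_upwards [eventually_gt_atTop j] with m hm
  exact (p_eq_q_sub_q hm).symm

theorem tendsto_q_floor {t : ℝ} (ht : t ∈ Set.Icc (0 : ℝ) 1) :
    Tendsto (fun m : ℕ => q m ⌊t * ((m : ℝ) - 1)⌋₊) atTop (𝓝 (1 / √(1 + 2 * t))) := by
  refine (tendsto_q_iff ht.1 ?_).2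
    ((tendsto_nat_floor_mul_div_atTop ht.1).comp tendsto_natCast_sub_one_atTop)
  filter_upwards [eventually_ge_atTop 1] with m hm
  have hm' : (1 : ℝ) ≤ m := by exact_mod_cast hm
  rw [Nat.floor_lt (mul_nonneg ht.1 (by linarith))]
  nlinarith [ht.2]

end GodelChain

theorem theorem6 :
    -- the limiting proportions `p_j(m)` exist
    (∀ m : ℕ, 2 ≤ m → ∀ j : ℕ, j < m →
      Tendsto (fun n : ℕ =>
          (GodelChain.levelCount m n j : ℝ) / (GodelChain.totalCount m n : ℝ))
        atTop (𝓝 (GodelChain.p m j))) ∧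
    -- the limiting proportion of outputs `≥ v_k` exists, is `q_k(m)`, and is a product
    (∀ m : ℕ, 2 ≤ m → ∀ k : ℕ, k < m →
      Tendsto (fun n : ℕ =>
          PowerSeries.coeff n (GodelChain.tailSeries m k) /
            PowerSeries.coeff n (GodelChain.totalSeries m))
        atTop (𝓝 (GodelChain.q m k)) ∧
      Tendsto (fun n : ℕ =>
          (GodelChain.atLeastCount m n k : ℝ) / (Nat.card (GodelChain.Row m n) : ℝ))
        atTop (𝓝 (GodelChain.q m k)) ∧
      GodelChain.q m k =
        ∏ j ∈ Finset.range k, deriv (GodelChain.Psi (GodelChain.r m)) (GodelChain.w m j)) ∧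
    (∀ m : ℕ, 2 ≤ m →
      GodelChain.q m (m - 1) = GodelChain.p m (m - 1) ∧
      ∀ k : ℕ, k + 1 < m →
        GodelChain.p m k = GodelChain.q m k - GodelChain.q m (k + 1)) ∧
    -- macroscopic cuts
    (∀ t : ℝ, t ∈ Set.Icc (0 : ℝ) 1 →
      Tendsto (fun m : ℕ => GodelChain.q m ⌊t * ((m : ℝ) - 1)⌋₊)
        atTop (𝓝 (1 / √(1 + 2 * t)))) ∧
    -- fixed levels carry vanishing mass
    (∀ j : ℕ, Tendsto (fun m : ℕ => GodelChain.p m j) atTop (𝓝 0)) ∧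
    -- a cut `k_m` has the limit `1 / √(1 + 2t)` exactly when its rank is macroscopic at `t`
    (∀ t : ℝ, t ∈ Set.Icc (0 : ℝ) 1 → ∀ k : ℕ → ℕ, (∀ m : ℕ, 2 ≤ m → k m < m) →
      (Tendsto (fun m : ℕ => GodelChain.q m (k m)) atTop (𝓝 (1 / √(1 + 2 * t))) ↔
        Tendsto (fun m : ℕ => (k m : ℝ) / ((m : ℝ) - 1)) atTop (𝓝 t))) := by
  refine ⟨fun m _ j hj => GodelChain.tendsto_levelCount_div hj, fun m _ k hk => ⟨?_, ?_, ?_⟩,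
    fun m hm => ⟨?_, fun k hk => GodelChain.p_eq_q_sub_q (by omega)⟩,
    fun t ht => GodelChain.tendsto_q_floor ht, GodelChain.tendsto_p_const,
    fun t ht k hk => GodelChain.tendsto_q_iff ht.1 ?_⟩
  · simp only [GodelChain.coeff_tailSeries _ hk.le, GodelChain.totalSeries, PowerSeries.coeff_mk]
    exact GodelChain.tendsto_atLeastCount_div_q hk
  · simp only [← GodelChain.totalCount_eq_card_row]
    exact GodelChain.tendsto_atLeastCount_div_q hk
  · exact GodelChain.q_eq_prod hk
  · rw [GodelChain.q, Nat.Ico_pred_singleton (by omega), Finset.sum_singleton]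
  · filter_upwards [eventually_ge_atTop 2] with m hm
    exact hk m hm
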